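/- Let $d\in\mathbb N$, let $m>d/2$ be a real number and let $r>0$. Let $\mathcal K=H_2^m(\mathbb R^d)$ be the Sobolev space of real-valued continuous functions $f\in L_2(\mathbb R^d)$ with $(1+\|\omega\|_2^2)^{m/2}\hat f\in L_2(\mathbb R^d)$, with the inner product $$(f,g)_K=\int_{\mathbb R^d}\hat f(\omega)\,\overline{\hat g(\omega)}\,(1+\|\omega\|_2^2)^m\,d\omega ,$$ where $\hat f$ is the Fourier transform of $f$, normalized to be unitary on $L_2(\mathbb R^d)$ with angular frequency $\omega$. It is a Hilbert space with continuous point evaluations; let $K$ be its reproducing kernel, so that $f(x)=(f,K(x,\cdot))_K$ for all $f\in\mathcal K$ and $x\in\mathbb R^d$. Let $$V_r=\{v\in\mathcal K : v(x)=0\ \text{for all}\ \|x\|_2\ge r\},$$ let $P_r$ be the orthogonal projector of $\mathcal K$ onto the closed subspace $V_r$, and put $g_{r,x}=P_rK(x,\cdot)$ and $$K_r(x,y)=(g_{r,x},g_{r,y})_K\qquad\text{for } x,y\in B_r(0)=\{z\in\mathbb R^d:\|z\|_2<r\}.$$ Let $\mathring H_2^m(B_r(0))$ be the closure in $\mathcal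 K$ of the set $C_0^\infty(B_r(0))$ of smooth functions with compact support in $B_r(0)$, with the inner product $(\cdot,\cdot)_K$, regarded as a Hilbert space of functions on $B_r(0)$. Then $K_r$ is the reproducing kernel of $\mathring H_2^m(B_r(0))$. -/

import Mathlib

open MeasureTheory FourierTransform SchwartzMap
open scoped ENNReal ContDiff InnerProductSpace

namespace HSobolev

/-- The Euclidean space `ℝ^d`. -/
abbrev E (d : ℕ) := EuclideanSpace ℝ (Fin d)

/-- The complex Hilbert space `L²(ℝ^d)`. -/
noncomputable abbrev L2 (d : ℕ) := Lp ℂ 2 (volume : Measure (E d))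

noncomputable section

/-- The `L²` inverse Fourier transform is given by the integral on integrable functions. -/
theorem fourierInv_ae_eq {d : ℕ} (u : L2 d) (hu : Integrable (u : E d → ℂ)) :
    ((𝓕⁻ u : L2 d) : E d → ℂ) =ᵐ[volume] 𝓕⁻ (u : E d → ℂ) := by
  have hcont : Continuous (𝓕⁻ (u : E d → ℂ)) :=
    VectorFourier.fourierIntegral_continuous Real.continuous_fourierChar
      (by exact continuous_inner.neg) hu
  refine ae_eq_of_integral_contDiff_smul_eq
    ((Lp.memLp _).locallyIntegrable (by norm_num)) hcont.locallyIntegrable ?_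
  intro g hg hgs
  have hg' : ContDiff ℝ ∞ (fun x => (g x : ℂ)) := Complex.ofRealCLM.contDiff.comp hg
  have hgs' : HasCompactSupport (fun x => (g x : ℂ)) :=
    hgs.comp_left (g := ((↑) : ℝ → ℂ)) Complex.ofReal_zero
  let G : 𝓢(E d, ℂ) := hgs'.toSchwartzMap hg'
  have hG : ∀ x, G x = (g x : ℂ) := fun x => rfl
  have h := congrArg (fun T => T G) (Lp.fourierInv_toTemperedDistribution_eq u)
  simp only [TemperedDistribution.fourierInv_apply, Lp.toTemperedDistribution_apply] at h
  have h2 : ∫ x, (𝓕⁻ G) x • (u : E d → ℂ) x = ∫ x, G x • 𝓕⁻ (u : E d → ℂ) x := by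
    have := VectorFourier.integral_fourierIntegral_smul_eq_flip (L := -innerₗ (E d))
      (μ := volume) (ν := volume)
      Real.continuous_fourierChar continuous_inner.neg G.integrable hu
    have e1 : ∀ x, VectorFourier.fourierIntegral Real.fourierChar volume (-innerₗ (E d)) (⇑G) x
        = (𝓕⁻ G) x := by
      intro x
      rw [fourierInv_coe]
      rfl
    have e2 : ∀ x, VectorFourier.fourierIntegral Real.fourierChar volume (-innerₗ (E d)).flip
        (u : E d → ℂ) x = 𝓕⁻ (u : E d → ℂ) x := by
      intro x
      simp [VectorFourier.fourierIntegral, Real.fourierInv_eq, real_inner_comm]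
    simpa only [e1, e2] using this
  rw [h2] at h
  simpa [hG, Complex.real_smul] using h.symm

variable {d : ℕ}

/-- The Bessel symbol `(1 + ‖ω‖²)^{m/2}` at the angular frequency `ω = 2πξ`. -/
def weight (m : ℝ) (ξ : E d) : ℝ := (1 + (2 * Real.pi * ‖ξ‖) ^ 2) ^ (m / 2)

theorem weight_pos (m : ℝ) (ξ : E d) : 0 < weight m ξ := by
  unfold weight; positivity

theorem continuous_weight (m : ℝ) : Continuous (weight m : E d → ℝ) := by
  unfold weight
  exact Continuous.rpow_const (by fun_prop) fun x => Or.inl (by positivity)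

/-- The `L²` Fourier transform of a real-valued square integrable function. -/
def hatL2 (f : E d → ℝ) (h : MemLp (fun x => (f x : ℂ)) 2 volume) : L2 d :=
  𝓕 (h.toLp _)

theorem hatL2_zero (h : MemLp (fun x => (((0 : E d → ℝ) x : ℝ) : ℂ)) 2 volume) :
    hatL2 (0 : E d → ℝ) h = 0 := by
  have : h.toLp _ = 0 := by
    rw [Lp.eq_zero_iff_ae_eq_zero]
    filter_upwards [h.coeFn_toLp] with x hx
    rw [hx]
    simp
  exact (congrArg (Lp.fourierTransformₗᵢ (E d) ℂ) this).trans (map_zero _)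

theorem hatL2_add {f g : E d → ℝ} (hf : MemLp (fun x => (f x : ℂ)) 2 volume)
    (hg : MemLp (fun x => (g x : ℂ)) 2 volume)
    (h : MemLp (fun x => (((f + g) x : ℝ) : ℂ)) 2 volume) :
    hatL2 (f + g) h = hatL2 f hf + hatL2 g hg := by
  have : h.toLp _ = hf.toLp _ + hg.toLp _ := by
    rw [← MemLp.toLp_add]
    refine MemLp.toLp_congr _ _ (Filter.Eventually.of_forall fun x => ?_)
    simp
  exact (congrArg (Lp.fourierTransformₗᵢ (E d) ℂ) this).trans (map_add _ _ _)

theorem hatL2_smul (c : ℝ) {f : E d → ℝ} (hf : MemLp (fun x => (f x : ℂ)) 2 volume)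
    (h : MemLp (fun x => (((c • f) x : ℝ) : ℂ)) 2 volume) :
    hatL2 (c • f) h = (c : ℂ) • hatL2 f hf := by
  have : h.toLp _ = (c : ℂ) • hf.toLp _ := by
    rw [← MemLp.toLp_const_smul]
    refine MemLp.toLp_congr _ _ (Filter.Eventually.of_forall fun x => ?_)
    simp
  exact (congrArg (Lp.fourierTransformₗᵢ (E d) ℂ) this).trans (map_smul _ _ _)

theorem weight_mul_add (m : ℝ) (u v : L2 d) :
    (fun ξ => (weight m ξ : ℂ) * u ξ) + (fun ξ => (weight m ξ : ℂ) * v ξ)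
      =ᵐ[volume] fun ξ => (weight m ξ : ℂ) * (u + v : L2 d) ξ := by
  filter_upwards [Lp.coeFn_add u v] with ξ hξ
  rw [hξ, Pi.add_apply, Pi.add_apply, mul_add]

theorem weight_mul_smul (m : ℝ) (c : ℂ) (u : L2 d) :
    c • (fun ξ => (weight m ξ : ℂ) * u ξ) =ᵐ[volume] fun ξ => (weight m ξ : ℂ) * (c • u : L2 d) ξ := by
  filter_upwards [Lp.coeFn_smul c u] with ξ hξ
  rw [hξ, Pi.smul_apply, Pi.smul_apply, smul_eq_mul, smul_eq_mul, mul_left_comm]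

/-- The real-valued functions of `H_2^m(ℝ^d)`, each class being represented by its continuous
member: continuous `f ∈ L²` whose `L²` Fourier transform satisfies `(1 + ‖ω‖²)^{m/2} f̂ ∈ L²`. -/
def sobolevSubmodule (d : ℕ) (m : ℝ) : Submodule ℝ (E d → ℝ) where
  carrier := {f | Continuous f ∧ ∃ h : MemLp (fun x => (f x : ℂ)) 2 volume,
    MemLp (fun ξ => (weight m ξ : ℂ) * hatL2 f h ξ) 2 volume}
  zero_mem' := by
    have h : MemLp (fun x : E d => (((0 : E d → ℝ) x : ℝ) : ℂ)) 2 volume := by simp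
    refine ⟨continuous_zero, h, ?_⟩
    rw [hatL2_zero h]
    refine MemLp.ae_eq (f := fun _ => 0) ?_ MemLp.zero
    filter_upwards [Lp.coeFn_zero ℂ 2 (volume : Measure (E d))] with ξ hξ
    rw [hξ, Pi.zero_apply, mul_zero]
  add_mem' := by
    rintro f g ⟨hf, hf2, hfw⟩ ⟨hg, hg2, hgw⟩
    have hs : MemLp (fun x => (((f + g) x : ℝ) : ℂ)) 2 (volume : Measure (E d)) := by
      simpa using! hf2.add hg2
    refine ⟨hf.add hg, hs, ?_⟩
    rw [hatL2_add hf2 hg2 hs]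
    exact (hfw.add hgw).ae_eq (weight_mul_add m _ _)
  smul_mem' := by
    rintro c f ⟨hf, hf2, hfw⟩
    have hs : MemLp (fun x => (((c • f) x : ℝ) : ℂ)) 2 (volume : Measure (E d)) := by
      simpa using! hf2.const_mul (c : ℂ)
    refine ⟨hf.const_smul c, hs, ?_⟩
    rw [hatL2_smul c hf2 hs]
    exact (hfw.const_smul (c : ℂ)).ae_eq (weight_mul_smul m _ _)

/-- The Sobolev space `H_2^m(ℝ^d)` for `m > d/2`, as a type of its own so that it carries the
Sobolev topology. -/
def H2 {d : ℕ} {m : ℝ} (_hm : (d : ℝ) / 2 < m) : Type := sobolevSubmodule d m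

variable {m : ℝ} {hm : (d : ℝ) / 2 < m}

instance : AddCommGroup (H2 hm) := inferInstanceAs (AddCommGroup (sobolevSubmodule d m))

instance : Module ℝ (H2 hm) := inferInstanceAs (Module ℝ (sobolevSubmodule d m))

namespace H2

/-- The function on `ℝ^d` that an element of `H_2^m(ℝ^d)` is. -/
def toFun : H2 hm →ₗ[ℝ] (E d → ℝ) := (sobolevSubmodule d m).subtype

theorem toFun_injective : Function.Injective (toFun : H2 hm → E d → ℝ) :=
  Subtype.val_injective

theorem continuous_toFun (f : H2 hm) : Continuous (toFun f) := f.2.1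

theorem memLp (f : H2 hm) : MemLp (fun x => (toFun f x : ℂ)) 2 volume := f.2.2.1

/-- The `L²` Fourier transform of `f`. -/
def hat (f : H2 hm) : L2 d := hatL2 (toFun f) (memLp f)

theorem memLp_weight (f : H2 hm) : MemLp (fun ξ => (weight m ξ : ℂ) * hat f ξ) 2 volume :=
  f.2.2.2

/-- The element `(1 + ‖ω‖²)^{m/2} f̂` of `L²`. -/
def bessel : H2 hm →ₗ[ℝ] L2 d where
  toFun f := (memLp_weight f).toLp _
  map_add' f g := by
    have : hat (f + g) = hat f + hat g := hatL2_add _ _ _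
    rw [← MemLp.toLp_add]
    refine MemLp.toLp_congr _ _ ?_
    rw [this]
    exact (weight_mul_add m _ _).symm
  map_smul' c f := by
    have : hat (c • f) = (c : ℂ) • hat f := hatL2_smul _ _ _
    have h2 : c • (memLp_weight f).toLp _ = (c : ℂ) • (memLp_weight f).toLp _ :=
      (Complex.coe_smul _ _).symm
    rw [RingHom.id_apply, h2, ← MemLp.toLp_const_smul]
    refine MemLp.toLp_congr _ _ ?_
    rw [this]
    exact (weight_mul_smul m _ _).symm

theorem bessel_coe (f : H2 hm) : bessel f =ᵐ[volume] fun ξ => (weight m ξ : ℂ) * hat f ξ :=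
  MemLp.coeFn_toLp (memLp_weight f)

/-- `bessel f` determines the Fourier transform of `f`. -/
theorem hat_ae (f : H2 hm) :
    hat f =ᵐ[volume] fun ξ => ((weight m ξ)⁻¹ : ℝ) * (bessel f : L2 d) ξ := by
  filter_upwards [bessel_coe f] with ξ hξ
  have := (weight_pos m ξ).ne'
  rw [hξ, ← mul_assoc, ← Complex.ofReal_mul, inv_mul_cancel₀ this, Complex.ofReal_one, one_mul]

theorem hat_fourierInv (f : H2 hm) : (𝓕⁻ (hat f) : L2 d) = (memLp f).toLp _ :=
  (Lp.fourierTransformₗᵢ (E d) ℂ).symm_apply_apply _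

end H2

theorem memLp_inv_weight (hm : (d : ℝ) / 2 < m) :
    MemLp (fun ξ : E d => (weight m ξ)⁻¹) 2 volume := by
  have hc : Continuous (fun ξ : E d => (weight m ξ)⁻¹) :=
    (continuous_weight m).inv₀ fun ξ => (weight_pos m ξ).ne'
  rw [memLp_two_iff_integrable_sq hc.aestronglyMeasurable]
  have hm0 : 0 < m := lt_of_le_of_lt (by positivity) hm
  have hi : Integrable (fun x : E d => ((1 : ℝ) + ‖x‖ ^ 2) ^ (-(2 * m) / 2)) volume :=
    integrable_rpow_neg_one_add_norm_sq (by
      rw [finrank_euclideanSpace, Fintype.card_fin]; linarith)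
  refine hi.mono' (hc.pow 2).aestronglyMeasurable (Filter.Eventually.of_forall fun ξ => ?_)
  have h1 : (weight m ξ)⁻¹ ^ 2 = (1 + (2 * Real.pi * ‖ξ‖) ^ 2) ^ (-m) := by
    unfold weight
    rw [← Real.rpow_neg (by positivity), ← Real.rpow_mul_natCast (by positivity)]
    congr 1
    push_cast
    ring
  rw [Real.norm_of_nonneg (by positivity), h1, show -(2 * m) / 2 = -m by ring]
  refine Real.rpow_le_rpow_of_nonpos (by positivity) ?_ (by linarith)
  have h2 : (1 : ℝ) ≤ 2 * Real.pi := by linarith [Real.pi_gt_three]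
  have h3 : ‖ξ‖ ≤ 2 * Real.pi * ‖ξ‖ := le_mul_of_one_le_left (norm_nonneg _) h2
  gcongr

theorem memLp_wave (hm : (d : ℝ) / 2 < m) (x : E d) :
    MemLp (fun ξ : E d => (((weight m ξ)⁻¹ : ℝ) : ℂ) * (Real.fourierChar (-(inner ℝ ξ x)) : ℂ)) 2
      volume := by
  have hc : Continuous (fun ξ : E d => (weight m ξ)⁻¹) :=
    (continuous_weight m).inv₀ fun ξ => (weight_pos m ξ).ne'
  refine (memLp_inv_weight hm).mono ?_ (Filter.Eventually.of_forall fun ξ => ?_)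
  · refine Continuous.aestronglyMeasurable ?_
    refine (Complex.continuous_ofReal.comp hc).mul ?_
    exact continuous_subtype_val.comp (Real.continuous_fourierChar.comp (by fun_prop))
  · rw [norm_mul, Circle.norm_coe, mul_one, Complex.norm_real]

/-- The representer in `L²` of point evaluation at `x`. -/
def wave (hm : (d : ℝ) / 2 < m) (x : E d) : L2 d := (memLp_wave hm x).toLp _

theorem integrable_of_ae (hm : (d : ℝ) / 2 < m) {u g : L2 d}
    (h : u =ᵐ[volume] fun ξ => (((weight m ξ)⁻¹ : ℝ) : ℂ) * g ξ) : Integrable u volume := by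
  refine Integrable.congr ?_ h.symm
  exact (memLp_inv_weight hm).ofReal.integrable_mul (Lp.memLp g)

theorem fourierInv_eq_inner (hm : (d : ℝ) / 2 < m) {u g : L2 d}
    (h : u =ᵐ[volume] fun ξ => (((weight m ξ)⁻¹ : ℝ) : ℂ) * g ξ) (x : E d) :
    𝓕⁻ (u : E d → ℂ) x = inner ℂ (wave hm x) g := by
  rw [MeasureTheory.L2.inner_def, Real.fourierInv_eq]
  refine integral_congr_ae ?_
  filter_upwards [h, (memLp_wave hm x).coeFn_toLp] with ξ h1 h2
  rw [h1, wave, h2, RCLike.inner_apply, map_mul, Complex.conj_ofReal, Circle.smul_def,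
    smul_eq_mul, ← Circle.coe_inv_eq_conj, ← AddChar.map_neg_eq_inv, neg_neg]
  ring

theorem continuous_fourierInv {u : E d → ℂ} (hu : Integrable u volume) : Continuous (𝓕⁻ u) :=
  VectorFourier.fourierIntegral_continuous Real.continuous_fourierChar
      (by exact continuous_inner.neg) hu

namespace H2

theorem toFun_eq_inner (f : H2 hm) (x : E d) :
    (toFun f x : ℂ) = inner ℂ (wave hm x) (bessel f) := by
  have hi := integrable_of_ae hm (hat_ae f)
  rw [← fourierInv_eq_inner hm (hat_ae f) x]
  have h1 := fourierInv_ae_eq (hat f) hi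
  rw [hat_fourierInv] at h1
  have h2 := (memLp f).coeFn_toLp.symm.trans h1
  exact congrFun ((Continuous.ae_eq_iff_eq (μ := volume)
    (Complex.continuous_ofReal.comp (continuous_toFun f)) (continuous_fourierInv hi)).1 h2) x

theorem bessel_injective : Function.Injective (bessel : H2 hm → L2 d) := by
  intro f g h
  apply toFun_injective
  ext x
  have := (toFun_eq_inner f x).trans ((congrArg _ h).trans (toFun_eq_inner g x).symm)
  exact_mod_cast this

/-- The Sobolev norm `‖f‖² = ∫ |f̂|² (1 + ‖ω‖²)^m`. -/
instance : NormedAddCommGroup (H2 hm) :=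
  NormedAddCommGroup.induced (H2 hm) (L2 d) bessel bessel_injective

theorem norm_def (f : H2 hm) : ‖f‖ = ‖bessel f‖ := rfl

/-- The Sobolev inner product `(f, g) = ∫ f̂ conj(ĝ) (1 + ‖ω‖²)^m`. -/
instance : InnerProductSpace ℝ (H2 hm) where
  inner f g := inner ℝ (bessel f) (bessel g)
  norm_smul_le c f := by
    rw [norm_def, norm_def, map_smul, norm_smul]
  norm_sq_eq_re_inner f := norm_sq_eq_re_inner (𝕜 := ℝ) (bessel f)
  conj_inner_symm f g := inner_conj_symm (𝕜 := ℝ) (bessel f) (bessel g)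
  add_left f g h := by rw [map_add, inner_add_left]
  smul_left f g c := by rw [map_smul, inner_smul_left]

theorem inner_eq (f g : H2 hm) : inner ℝ f g = inner ℝ (bessel f) (bessel g) := rfl

/-- `bessel` as an isometry. -/
def besselₗᵢ : H2 hm →ₗᵢ[ℝ] L2 d := ⟨bessel, fun _ => rfl⟩

theorem isClosed_range : IsClosed (Set.range (besselₗᵢ : H2 hm → L2 d)) := by
  refine isClosed_of_closure_subset fun g hg => ?_
  have hc : Continuous (fun ξ : E d => (weight m ξ)⁻¹) :=
    (continuous_weight m).inv₀ fun ξ => (weight_pos m ξ).ne'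
  have hm0 : 0 < m := lt_of_le_of_lt (by positivity) hm
  have hreal : ∀ x, (inner ℂ (wave hm x) g).im = 0 := by
    intro x
    have hcl : IsClosed {g : L2 d | (inner ℂ (wave hm x) g).im = 0} :=
      isClosed_eq (Complex.continuous_im.comp (by fun_prop)) continuous_const
    refine hcl.closure_subset_iff.2 ?_ hg
    rintro _ ⟨f, rfl⟩
    change (inner ℂ (wave hm x) (bessel f)).im = 0
    rw [← toFun_eq_inner, Complex.ofReal_im]
  have hu2 : MemLp (fun ξ => (((weight m ξ)⁻¹ : ℝ) : ℂ) * g ξ) 2 volume := by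
    refine (Lp.memLp g).mono ((Complex.continuous_ofReal.comp hc).aestronglyMeasurable.mul
      (Lp.aestronglyMeasurable g)) (Filter.Eventually.of_forall fun ξ => ?_)
    have h1 : 1 ≤ weight m ξ := Real.one_le_rpow (by nlinarith [sq_nonneg (2 * Real.pi * ‖ξ‖)])
      (by positivity)
    rw [norm_mul, Complex.norm_real, Real.norm_of_nonneg (by positivity)]
    exact mul_le_of_le_one_left (norm_nonneg _) (inv_le_one_of_one_le₀ h1)
  set u : L2 d := hu2.toLp _ with hu
  have hug : u =ᵐ[volume] fun ξ => (((weight m ξ)⁻¹ : ℝ) : ℂ) * g ξ := hu2.coeFn_toLp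
  have hi := integrable_of_ae hm hug
  have hF : ∀ x, ((inner ℂ (wave hm x) g).re : ℂ) = 𝓕⁻ (u : E d → ℂ) x := by
    intro x
    rw [fourierInv_eq_inner hm hug]
    exact Complex.ext (by simp) (by simp [hreal x])
  have hFc : Continuous fun x => (inner ℂ (wave hm x) g).re := by
    have := Complex.continuous_re.comp (continuous_fourierInv hi)
    refine this.congr fun x => ?_
    rw [Function.comp_apply, ← hF, Complex.ofReal_re]
  have hae : ((𝓕⁻ u : L2 d) : E d → ℂ) =ᵐ[volume]
      fun x => ((inner ℂ (wave hm x) g).re : ℂ) := by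
    refine (fourierInv_ae_eq u hi).trans (Filter.Eventually.of_forall fun x => ?_)
    exact (hF x).symm
  have hF2 : MemLp (fun x => ((inner ℂ (wave hm x) g).re : ℂ)) 2 volume :=
    (Lp.memLp (𝓕⁻ u : L2 d)).ae_eq hae
  have hhat : hatL2 (fun x => (inner ℂ (wave hm x) g).re) hF2 = u := by
    have : hF2.toLp _ = (𝓕⁻ u : L2 d) := by
      rw [← Lp.toLp_coeFn (𝓕⁻ u : L2 d) (Lp.memLp _)]
      exact MemLp.toLp_congr _ _ hae.symm
    unfold hatL2
    rw [this]
    exact (Lp.fourierTransformₗᵢ (E d) ℂ).apply_symm_apply u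
  have hwu : (fun ξ => (weight m ξ : ℂ) * u ξ) =ᵐ[volume] g := by
    filter_upwards [hug] with ξ hξ
    have := (weight_pos m ξ).ne'
    rw [hξ, ← mul_assoc, ← Complex.ofReal_mul, mul_inv_cancel₀ this, Complex.ofReal_one, one_mul]
  let f : H2 hm := ⟨fun x => (inner ℂ (wave hm x) g).re, hFc, hF2, by
    rw [hhat]; exact (Lp.memLp g).ae_eq hwu.symm⟩
  refine ⟨f, ?_⟩
  have h1 : hat f = u := hhat
  refine Lp.ext ((bessel_coe f).trans ?_)
  rw [h1]
  exact hwu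

instance : CompleteSpace (H2 hm) :=
  (besselₗᵢ (hm := hm)).isometry.isUniformInducing.completeSpace isClosed_range.isComplete

theorem continuous_eval (x : E d) : Continuous fun f : H2 hm => toFun f x := by
  have h : Continuous fun f : H2 hm => (inner ℂ (wave hm x) (bessel f)).re :=
    Complex.continuous_re.comp
      (continuous_const.inner (besselₗᵢ (hm := hm)).continuous)
  refine h.congr fun f => ?_
  rw [← toFun_eq_inner, Complex.ofReal_re]

/-- `H_2^m(ℝ^d)` is a reproducing kernel Hilbert space of real-valued functions on `ℝ^d`. -/
instance : RKHS ℝ (H2 hm) (E d) ℝ where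
  coeCLM := ⟨toFun, continuous_pi continuous_eval⟩
  coeCLM_injective := toFun_injective

end H2

/-- The translate `K(x, ·)` of the reproducing kernel `K` of `H_2^m(ℝ^d)`. -/
def kernelTranslate (hm : (d : ℝ) / 2 < m) (x : E d) : H2 hm := RKHS.kerFun (H2 hm) x 1

/-- `V_r = {v ∈ H_2^m(ℝ^d) : v(x) = 0 for all ‖x‖ ≥ r}`. -/
def Vr (hm : (d : ℝ) / 2 < m) (r : ℝ) : Submodule ℝ (H2 hm) where
  carrier := {v | ∀ x : E d, r ≤ ‖x‖ → v x = 0}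
  zero_mem' := by simp
  add_mem' := by
    intro f g hf hg x hx
    simp [hf x hx, hg x hx]
  smul_mem' := by
    intro c f hf x hx
    simp [hf x hx]

theorem isClosed_Vr (hm : (d : ℝ) / 2 < m) (r : ℝ) : IsClosed (Vr hm r : Set (H2 hm)) := by
  have : (Vr hm r : Set (H2 hm)) = ⋂ x : E d, ⋂ _ : r ≤ ‖x‖, {v | v x = 0} := by
    ext; simp [Vr]
  rw [this]
  exact isClosed_iInter fun x => isClosed_iInter fun _ =>
    isClosed_eq (RKHS.continuous_eval x) continuous_const

instance (hm : (d : ℝ) / 2 < m) (r : ℝ) : CompleteSpace (Vr hm r) :=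
  (isClosed_Vr hm r).completeSpace_coe

/-- `g_{r,x} = P_r K(x, ·)`, with `P_r` the orthogonal projector onto `V_r`. -/
def gr (hm : (d : ℝ) / 2 < m) (r : ℝ) (x : E d) : H2 hm :=
  (Vr hm r).starProjection (kernelTranslate hm x)

/-- `K_r(x, y) = (g_{r,x}, g_{r,y})_K` for `x, y ∈ B_r(0)`. -/
def Kr (hm : (d : ℝ) / 2 < m) (r : ℝ) (x y : Metric.ball (0 : E d) r) : ℝ :=
  inner ℝ (gr hm r x) (gr hm r y)

/-- `C_0^∞(B_r(0))`: the smooth functions whose support is a compact subset of the open ball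
(all of them belong to `H_2^m(ℝ^d)`). -/
def testFunctions (hm : (d : ℝ) / 2 < m) (r : ℝ) : Submodule ℝ (H2 hm) where
  carrier := {f | ContDiff ℝ ∞ (f : E d → ℝ) ∧ HasCompactSupport (f : E d → ℝ) ∧
    tsupport (f : E d → ℝ) ⊆ Metric.ball 0 r}
  zero_mem' := by
    refine ⟨?_, ?_, ?_⟩
    · rw [RKHS.coe_zero]; exact contDiff_const
    · rw [RKHS.coe_zero]; exact HasCompactSupport.zero
    · rw [RKHS.coe_zero]; simp
  add_mem' := by
    rintro f g ⟨hf1, hf2, hf3⟩ ⟨hg1, hg2, hg3⟩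
    refine ⟨?_, ?_, ?_⟩
    · rw [RKHS.coe_add]; exact hf1.add hg1
    · rw [RKHS.coe_add]; exact hf2.add hg2
    · rw [RKHS.coe_add]; exact (tsupport_add _ _).trans (Set.union_subset hf3 hg3)
  smul_mem' := by
    rintro c f ⟨hf1, hf2, hf3⟩
    refine ⟨?_, ?_, ?_⟩
    · rw [RKHS.coe_smul]; exact contDiff_const.smul hf1
    · rw [RKHS.coe_smul]; exact hf2.smul_left (f := fun _ => c)
    · rw [RKHS.coe_smul]; exact (tsupport_smul_subset_right (fun _ => c) _).trans hf3

/-- `H̊_2^m(B_r(0))`: the closure of `C_0^∞(B_r(0))` in the norm of `H_2^m(ℝ^d)`, a Hilbert space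
with the inner product of `H_2^m(ℝ^d)`. -/
def H2Zero (hm : (d : ℝ) / 2 < m) (r : ℝ) : Submodule ℝ (H2 hm) :=
  (testFunctions hm r).topologicalClosure

instance (hm : (d : ℝ) / 2 < m) (r : ℝ) : CompleteSpace (H2Zero hm r) :=
  (Submodule.isClosed_topologicalClosure _).completeSpace_coe

theorem H2Zero_le_Vr (hm : (d : ℝ) / 2 < m) (r : ℝ) : H2Zero hm r ≤ Vr hm r := by
  refine Submodule.topologicalClosure_minimal _ ?_ (isClosed_Vr hm r)
  rintro f ⟨-, -, hf⟩ x hx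
  by_contra h
  have := hf (subset_tsupport _ h)
  rw [mem_ball_zero_iff] at this
  linarith

/-- `H̊_2^m(B_r(0))` as a reproducing kernel Hilbert space of functions on the ball `B_r(0)`: the
restriction to the ball is injective, as the functions vanish outside. -/
instance (hm : (d : ℝ) / 2 < m) (r : ℝ) : RKHS ℝ (H2Zero hm r) (Metric.ball (0 : E d) r) ℝ where
  coeCLM := .pi fun x => (.proj (x : E d) ∘L RKHS.coeCLM ℝ) ∘L (H2Zero hm r).subtypeL
  coeCLM_injective := by
    intro f g h
    refine Subtype.ext (RKHS.ext fun x => ?_)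
    by_cases hx : x ∈ Metric.ball (0 : E d) r
    · exact congrFun h ⟨x, hx⟩
    · rw [mem_ball_zero_iff, not_lt] at hx
      rw [H2Zero_le_Vr hm r f.2 x hx, H2Zero_le_Vr hm r g.2 x hx]

end

end HSobolev

/-! Everything rests on the equality of `V_r` with the closure of the test functions. Once it is
known, the kernel functions of the closure are the projections `g_{r,y}`, and their inner products
give the kernel.

One inclusion holds because `V_r` is closed. For the other, take `v` in `V_r`, shrink it to `v (s⁻¹
• x)` with `s < 1`, and mollify within the gap gained at the boundary: the result is a test function
(`tsupport_mollify_subset`). On the Fourier side its transform is dominated by that of `v` at `s •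
ξ`, so its Sobolev norm stays bounded for `1/2 ≤ s ≤ 1` (`exists_testFunction_eq_mollify`). As `s →
1` these functions converge to `v` pointwise.

Norm convergence is never needed. Kernel functions span a dense subspace, so bounded pointwise
convergence is weak convergence, and the closure of a subspace contains its weak limits. -/

open Filter Topology

/-! ### Weak convergence in reproducing kernel Hilbert spaces -/

/-- In a reproducing kernel Hilbert space, bounded pointwise convergent sequences converge
weakly. -/
theorem RKHS.tendsto_inner_of_tendsto_apply {X H : Type*} [NormedAddCommGroup H]
    [InnerProductSpace ℝ H] [CompleteSpace H] [RKHS ℝ H X ℝ] {w : ℕ → H} {v : H} {C : ℝ}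
    (hC : ∀ n, ‖w n‖ ≤ C) (hw : ∀ x, Tendsto (fun n => w n x) atTop (𝓝 (v x))) (u : H) :
    Tendsto (fun n => inner ℝ u (w n)) atTop (𝓝 (inner ℝ u v)) := by
  have hspan : ∀ u ∈ Submodule.span ℝ {f : H | ∃ x c, RKHS.kerFun H x c = f},
      Tendsto (fun n => inner ℝ u (w n)) atTop (𝓝 (inner ℝ u v)) := by
    intro u hu
    induction hu using Submodule.span_induction with
    | mem u hu =>
      obtain ⟨x, c, rfl⟩ := hu
      simp only [RKHS.kerFun_inner]
      exact tendsto_const_nhds.inner (hw x)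
    | zero => simp
    | add f g _ _ hf hg => simpa only [inner_add_left] using hf.add hg
    | smul c f _ hf => simpa only [real_inner_smul_left] using hf.const_mul c
  have hu : u ∈ closure (Submodule.span ℝ {f : H | ∃ x c, RKHS.kerFun H x c = f} : Set H) := by
    rw [← Submodule.topologicalClosure_coe, RKHS.kerFun_dense]
    trivial
  have hC0 : 0 ≤ C := (norm_nonneg _).trans (hC 0)
  rw [Metric.tendsto_atTop]
  intro ε hε
  -- Since `‖w n - v‖ ≤ C + ‖v‖`, replacing `u` by `u'` costs less than `ε / 2`; the extra `1` keeps
  -- the divisor positive.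
  obtain ⟨u', hu', hd⟩ := Metric.mem_closure_iff.1 hu (ε / (2 * (C + ‖v‖ + 1))) (by positivity)
  rw [dist_eq_norm, lt_div_iff₀ (by positivity)] at hd
  obtain ⟨N, hN⟩ := Metric.tendsto_atTop.1 (hspan u' hu') (ε / 2) (by positivity)
  refine ⟨N, fun n hn => ?_⟩
  have h1 := hN n hn
  rw [Real.dist_eq] at h1 ⊢
  have h2 : inner ℝ u (w n) - inner ℝ u v
      = inner ℝ (u - u') (w n - v) + (inner ℝ u' (w n) - inner ℝ u' v) := by
    simp only [inner_sub_left, inner_sub_right]; ring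
  have h3 : |inner ℝ (u - u') (w n - v)| ≤ ‖u - u'‖ * (C + ‖v‖ + 1) := by
    refine (abs_real_inner_le_norm _ _).trans ?_
    gcongr
    linarith [norm_sub_le (w n) v, hC n]
  rw [h2]
  linarith [abs_add_le (inner ℝ (u - u') (w n - v)) (inner ℝ u' (w n) - inner ℝ u' v)]

/-- A subspace of a reproducing kernel Hilbert space has all bounded pointwise limits in its
closure. -/
theorem RKHS.mem_topologicalClosure_of_tendsto_apply {X H : Type*} [NormedAddCommGroup H]
    [InnerProductSpace ℝ H] [CompleteSpace H] [RKHS ℝ H X ℝ] {S : Submodule ℝ H} {w : ℕ → H}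
    {v : H} {C : ℝ} (hS : ∀ n, w n ∈ S) (hC : ∀ n, ‖w n‖ ≤ C)
    (hw : ∀ x, Tendsto (fun n => w n x) atTop (𝓝 (v x))) : v ∈ S.topologicalClosure := by
  rw [← Submodule.orthogonal_orthogonal_eq_closure, Submodule.mem_orthogonal]
  intro u hu
  -- For `u` orthogonal to `S` the sequence `inner ℝ u (w n)` is identically zero, hence so is its
  -- limit `inner ℝ u v`.
  refine tendsto_nhds_unique (RKHS.tendsto_inner_of_tendsto_apply hC hw u) ?_
  simp [Submodule.inner_left_of_mem_orthogonal (hS _) hu]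

namespace HSobolev

variable {d : ℕ} {m : ℝ}

/-! ### Fourier integrals, weights and dilations -/

/-- The `L²` Fourier transform is given by the integral on integrable functions. -/
theorem fourier_ae_eq (u : L2 d) (hu : Integrable (u : E d → ℂ)) :
    ((𝓕 u : L2 d) : E d → ℂ) =ᵐ[volume] 𝓕 (u : E d → ℂ) := by
  have hcont : Continuous (𝓕 (u : E d → ℂ)) :=
    VectorFourier.fourierIntegral_continuous Real.continuous_fourierChar
      (by exact continuous_inner) hu
  refine ae_eq_of_integral_contDiff_smul_eq
    ((Lp.memLp _).locallyIntegrable (by norm_num)) hcont.locallyIntegrable ?_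
  intro g hg hgs
  have hg' : ContDiff ℝ ∞ (fun x => (g x : ℂ)) := Complex.ofRealCLM.contDiff.comp hg
  have hgs' : HasCompactSupport (fun x => (g x : ℂ)) :=
    hgs.comp_left (g := ((↑) : ℝ → ℂ)) Complex.ofReal_zero
  let G : 𝓢(E d, ℂ) := hgs'.toSchwartzMap hg'
  have hG : ∀ x, G x = (g x : ℂ) := fun x => rfl
  have h := congrArg (fun T => T G) (Lp.fourier_toTemperedDistribution_eq u)
  simp only [TemperedDistribution.fourier_apply, Lp.toTemperedDistribution_apply] at h
  -- Fubini moves the transform from the test function to `u`; the distributional definition does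
  -- the same for the `L²` transform.
  have h2 : ∫ x, (𝓕 G) x • (u : E d → ℂ) x = ∫ x, G x • 𝓕 (u : E d → ℂ) x := by
    have := VectorFourier.integral_fourierIntegral_smul_eq_flip (L := innerₗ (E d))
      (μ := volume) (ν := volume)
      Real.continuous_fourierChar continuous_inner G.integrable hu
    rw [flip_innerₗ] at this
    rw [fourier_coe]
    exact this
  rw [h2] at h
  simpa [hG, Complex.real_smul] using h.symm

theorem hatL2_ae_eq_fourier {f : E d → ℝ} (h2 : MemLp (fun x => (f x : ℂ)) 2 volume)
    (h1 : Integrable f) : hatL2 f h2 =ᵐ[volume] 𝓕 (fun x => (f x : ℂ)) := by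
  have hae := h2.coeFn_toLp
  refine (fourier_ae_eq _ (h1.ofReal.congr hae.symm)).trans (Eventually.of_forall fun ξ => ?_)
  rw [Real.fourier_eq, Real.fourier_eq]
  refine integral_congr_ae ?_
  filter_upwards [hae] with x hx
  rw [hx]

theorem fourier_comp_smul (f : E d → ℂ) {s : ℝ} (hs : 0 < s) (ξ : E d) :
    𝓕 (fun x => f (s⁻¹ • x)) ξ = (s ^ d : ℝ) • 𝓕 f (s • ξ) := by
  have h := Measure.integral_comp_inv_smul_of_nonneg (volume : Measure (E d))
    (fun y => Real.fourierChar (-(inner ℝ y (s • ξ))) • f y) hs.le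
  rw [finrank_euclideanSpace, Fintype.card_fin] at h
  rw [Real.fourier_eq, Real.fourier_eq, ← h]
  congr 1 with x
  rw [real_inner_smul_left, real_inner_smul_right, inv_mul_cancel_left₀ hs.ne']

theorem norm_fourier_le (f : E d → ℂ) (ξ : E d) : ‖𝓕 f ξ‖ ≤ ∫ x, ‖f x‖ :=
  VectorFourier.norm_fourierIntegral_le_integral_norm _ _ _ _ _

/-- Multiplying `1 + (2πs‖ξ‖)²` by `s⁻²` gives `s⁻² + (2π‖ξ‖)²`, which is at least `1 + (2π‖ξ‖)²`;
then raise to the power `m / 2`. -/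
theorem weight_le_weight_smul (hm : 0 ≤ m) {s : ℝ} (h0 : 0 < s) (h1 : s ≤ 1) (ξ : E d) :
    weight m ξ ≤ (s⁻¹) ^ m * weight m (s • ξ) := by
  have hs : (s⁻¹) ^ m = ((s⁻¹) ^ 2) ^ (m / 2) := by
    rw [← Real.rpow_natCast_mul (by positivity)]
    congr 1; push_cast; ring
  unfold weight
  rw [hs, ← Real.mul_rpow (by positivity) (by positivity)]
  refine Real.rpow_le_rpow (by positivity) ?_ (by positivity)
  rw [norm_smul, Real.norm_of_nonneg h0.le]
  have h2 : 1 ≤ s⁻¹ ^ 2 := one_le_pow₀ ((one_le_inv₀ h0).2 h1)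
  have h3 : s⁻¹ ^ 2 * (1 + (2 * Real.pi * (s * ‖ξ‖)) ^ 2)
      = s⁻¹ ^ 2 + (2 * Real.pi * ‖ξ‖) ^ 2 := by
    field_simp
  rw [h3]
  linarith

/-- The change of variables contributes the factor `s ^ (-d/2)`, and `s ≥ 1/2` makes the bound
uniform in `s`. -/
theorem eLpNorm_comp_smul_le {f : E d → ℂ} (hf : AEStronglyMeasurable f) {s : ℝ} (hs : 1 / 2 ≤ s) :
    eLpNorm (fun ξ => f (s • ξ)) 2 volume
      ≤ (ENNReal.ofReal (2 ^ d)) ^ (1 / 2 : ℝ) * eLpNorm f 2 volume := by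
  have hs0 : 0 < s := by linarith
  have hmap : Measure.map (s • ·) (volume : Measure (E d))
      = ENNReal.ofReal |(s ^ d)⁻¹| • volume := by
    simpa using Measure.map_addHaar_smul (volume : Measure (E d)) hs0.ne'
  have h1 : eLpNorm (fun ξ => f (s • ξ)) 2 volume
      = eLpNorm f 2 (Measure.map (s • ·) (volume : Measure (E d))) := by
    rw [eLpNorm_map_measure _ (by fun_prop)]
    · rfl
    · rw [hmap]; exact hf.smul_measure _
  rw [h1, hmap, eLpNorm_smul_measure_of_ne_top (by norm_num), smul_eq_mul]
  have h2 : |(s ^ d)⁻¹| ≤ 2 ^ d := by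
    rw [abs_of_pos (by positivity), ← inv_pow]
    refine pow_le_pow_left₀ (by positivity) ?_ d
    rw [inv_le_comm₀ hs0 two_pos]
    linarith
  rw [show (1 / 2 : ℝ≥0∞).toReal = (1 / 2 : ℝ) by simp]
  gcongr

variable {hm : (d : ℝ) / 2 < m}

open scoped Convolution Pointwise
open ContinuousLinearMap (lsmul)

theorem hasCompactSupport_of_mem_Vr {r : ℝ} {v : H2 hm} (hv : v ∈ Vr hm r) :
    HasCompactSupport v :=
  HasCompactSupport.intro (isCompact_closedBall 0 r) fun x hx => hv x (by
    rw [mem_closedBall_zero_iff, not_le] at hx; exact hx.le)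

/-- The weighted Fourier integral of an integrable member of `H_2^m(ℝ^d)`. -/
theorem H2.bessel_ae_eq_fourier (f : H2 hm) (h1 : Integrable f) :
    H2.bessel f =ᵐ[volume] fun ξ => (weight m ξ : ℂ) * 𝓕 (fun x => (f x : ℂ)) ξ := by
  filter_upwards [H2.bessel_coe f, hatL2_ae_eq_fourier (H2.memLp f) h1] with ξ hξ hξ'
  rw [hξ]
  congr 1

/-- A continuous compactly supported function belongs to `H_2^m(ℝ^d)` as soon as its weighted
Fourier integral is square integrable. -/
theorem H2.exists_of_memLp {f : E d → ℝ} (hc : Continuous f) (hs : HasCompactSupport f)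
    (h : MemLp (fun ξ => (weight m ξ : ℂ) * 𝓕 (fun x => (f x : ℂ)) ξ) 2 volume) :
    ∃ F : H2 hm, ⇑F = f := by
  have h2 : MemLp (fun x => (f x : ℂ)) 2 volume :=
    (hc.memLp_of_hasCompactSupport hs).ofReal
  refine ⟨(⟨f, hc, h2, h.ae_eq ?_⟩ : sobolevSubmodule d m), rfl⟩
  filter_upwards [hatL2_ae_eq_fourier h2 (hc.integrable_of_hasCompactSupport hs)] with ξ hξ
  rw [hξ]

/-! ### Mollified dilates -/

/-- The mollification of a dilate of `v`. -/
noncomputable def mollify (φ : ContDiffBump (0 : E d)) (s : ℝ) (v : E d → ℝ) : E d → ℝ :=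
  φ.normed volume ⋆[lsmul ℝ ℝ, volume] fun x => v (s⁻¹ • x)

section mollify

variable {v : E d → ℝ} (φ : ContDiffBump (0 : E d)) {s r : ℝ}

theorem contDiff_mollify (hc : Continuous v) : ContDiff ℝ ∞ (mollify φ s v) :=
  φ.hasCompactSupport_normed.contDiff_convolution_left _ φ.contDiff_normed
    (hc.comp (by fun_prop)).locallyIntegrable

/-- Supports add under convolution: the bump contributes `φ.rOut`, the dilate `s * r`. -/
theorem tsupport_mollify_subset (hs : 0 < s) (hv : ∀ x, r ≤ ‖x‖ → v x = 0) :
    tsupport (mollify φ s v) ⊆ Metric.closedBall 0 (φ.rOut + s * r) := by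
  refine closure_minimal ?_ Metric.isClosed_closedBall
  refine (support_convolution_subset _).trans ?_
  rintro _ ⟨a, ha, b, hb, rfl⟩
  rw [φ.support_normed_eq, mem_ball_zero_iff] at ha
  have hb' : ‖b‖ < s * r := by
    by_contra! h
    refine hb (hv _ ?_)
    rwa [norm_smul, Real.norm_of_nonneg (by positivity), le_inv_mul_iff₀ hs]
  rw [mem_closedBall_zero_iff]
  exact (norm_add_le _ _).trans (by linarith)

/-- The transform of the convolution is a product. The bump is nonnegative with integral one, so its
transform is at most `1` in modulus; the Jacobian `s ^ d` of the dilation is at most `1` too. -/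
theorem norm_fourier_mollify_le (hc : Continuous v) (hv : HasCompactSupport v) (h0 : 0 < s)
    (h1 : s ≤ 1) (ξ : E d) :
    ‖𝓕 (fun x => (mollify φ s v x : ℂ)) ξ‖ ≤ ‖𝓕 (fun x => (v x : ℂ)) (s • ξ)‖ := by
  have hvs : Integrable fun x => v (s⁻¹ • x) :=
    (hc.integrable_of_hasCompactSupport hv).comp_smul (inv_ne_zero h0.ne')
  have hconv : (fun x => (mollify φ s v x : ℂ))
      = (fun x => (φ.normed volume x : ℂ)) ⋆[lsmul ℂ ℂ, volume] fun x => (v (s⁻¹ • x) : ℂ) := by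
    ext x
    simp only [mollify, MeasureTheory.convolution, ContinuousLinearMap.lsmul_apply, smul_eq_mul]
    rw [← integral_complex_ofReal]
    simp
  have hφi : Integrable (fun x => (φ.normed volume x : ℂ)) := φ.integrable_normed.ofReal
  have hvi : Integrable (fun x => (v (s⁻¹ • x) : ℂ)) := hvs.ofReal
  rw [hconv, Real.fourier_smul_convolution_eq hφi hvi,
    fourier_comp_smul (fun x => (v x : ℂ)) h0, norm_smul, norm_smul]
  have h2 : ‖𝓕 (fun x => (φ.normed volume x : ℂ)) ξ‖ ≤ 1 := by
    refine (norm_fourier_le _ _).trans_eq ?_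
    rw [← φ.integral_normed (μ := volume)]
    congr 1 with x
    rw [Complex.norm_real, Real.norm_of_nonneg (φ.nonneg_normed x)]
  have h3 : ‖s ^ d‖ ≤ 1 := by
    rw [Real.norm_of_nonneg (by positivity)]
    exact pow_le_one₀ h0.le h1
  calc _ ≤ 1 * (1 * ‖𝓕 (fun x => (v x : ℂ)) (s • ξ)‖) := by gcongr
    _ = _ := by ring

end mollify

/-- The mollified dilates of `v` are bounded in `H_2^m(ℝ^d)`. -/
theorem exists_testFunction_eq_mollify {r : ℝ} {v : H2 hm} (hv : v ∈ Vr hm r)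
    (φ : ContDiffBump (0 : E d)) {s : ℝ} (h0 : 1 / 2 ≤ s) (h1 : s ≤ 1)
    (hsr : φ.rOut + s * r < r) :
    ∃ w ∈ testFunctions hm r, ⇑w = mollify φ s v ∧
      ‖w‖ ≤ 2 ^ m * (((2 : ℝ) ^ d) ^ (1 / 2 : ℝ) * ‖v‖) := by
  have hm0 : 0 < m := lt_of_le_of_lt (by positivity) hm
  have hs0 : 0 < s := by linarith
  have hvc : Continuous v := H2.continuous_toFun v
  have hvs := hasCompactSupport_of_mem_Vr hv
  set h : E d → ℂ := fun ξ => (weight m ξ : ℂ) * 𝓕 (fun x => (v x : ℂ)) ξ with hh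
  have hvb : H2.bessel v =ᵐ[volume] h :=
    H2.bessel_ae_eq_fourier v (hvc.integrable_of_hasCompactSupport hvs)
  have hL : MemLp h 2 volume := (Lp.memLp _).ae_eq hvb
  have hwc := contDiff_mollify (s := s) φ hvc
  have hws := tsupport_mollify_subset φ hs0 hv
  have hwcs : HasCompactSupport (mollify φ s v) :=
    (isCompact_closedBall _ _).of_isClosed_subset (isClosed_tsupport _) hws
  set k : E d → ℂ := fun ξ => (weight m ξ : ℂ) * 𝓕 (fun x => (mollify φ s v x : ℂ)) ξ with hk
  have hwi := hwc.continuous.integrable_of_hasCompactSupport (μ := volume) hwcs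
  have hkc : Continuous k :=
    (Complex.continuous_ofReal.comp (continuous_weight m)).mul
      (VectorFourier.fourierIntegral_continuous Real.continuous_fourierChar
        (by exact continuous_inner) hwi.ofReal)
  have hkh : ∀ ξ, ‖k ξ‖ ≤ 2 ^ m * ‖h (s • ξ)‖ := by
    intro ξ
    have h2 : s⁻¹ ^ m ≤ 2 ^ m := by
      refine Real.rpow_le_rpow (by positivity) ?_ hm0.le
      rw [inv_le_comm₀ hs0 two_pos]; linarith
    simp only [hk, hh, norm_mul, Complex.norm_real, Real.norm_of_nonneg (weight_pos m _).le]
    rw [← mul_assoc]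
    refine mul_le_mul ((weight_le_weight_smul hm0.le hs0 h1 ξ).trans ?_)
      (norm_fourier_mollify_le φ hvc hvs hs0 h1 ξ) (norm_nonneg _)
      (mul_nonneg (by positivity) (weight_pos m _).le)
    exact mul_le_mul_of_nonneg_right h2 (weight_pos m _).le
  have hkn : eLpNorm k 2 volume ≤ ENNReal.ofReal (2 ^ m) *
      ((ENNReal.ofReal (2 ^ d)) ^ (1 / 2 : ℝ) * eLpNorm h 2 volume) := by
    refine (eLpNorm_le_mul_eLpNorm_of_ae_le_mul (Eventually.of_forall hkh) 2).trans ?_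
    gcongr
    exact eLpNorm_comp_smul_le hL.1 h0
  have hfin : ENNReal.ofReal (2 ^ m) *
      ((ENNReal.ofReal (2 ^ d)) ^ (1 / 2 : ℝ) * eLpNorm h 2 volume) ≠ ⊤ :=
    ENNReal.mul_ne_top ENNReal.ofReal_ne_top (ENNReal.mul_ne_top
      (ENNReal.rpow_ne_top_of_nonneg (by norm_num) ENNReal.ofReal_ne_top) hL.2.ne)
  have hkL : MemLp k 2 volume := ⟨hkc.aestronglyMeasurable, hkn.trans_lt hfin.lt_top⟩
  -- The norm estimate does double duty: its finiteness puts the mollified dilate in the Sobolev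
  -- space.
  obtain ⟨w, hw⟩ := H2.exists_of_memLp (hm := hm) hwc.continuous hwcs hkL
  refine ⟨w, ⟨?_, ?_, ?_⟩, hw, ?_⟩
  · rwa [hw]
  · rwa [hw]
  · rw [hw]
    exact hws.trans (Metric.closedBall_subset_ball hsr)
  · have hwb : H2.bessel w =ᵐ[volume] k := by
      have := H2.bessel_ae_eq_fourier w (by rwa [hw])
      rwa [hw] at this
    rw [H2.norm_def, H2.norm_def, Lp.norm_def, Lp.norm_def, eLpNorm_congr_ae hwb,
      eLpNorm_congr_ae hvb]
    refine (ENNReal.toReal_mono hfin hkn).trans_eq ?_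
    rw [ENNReal.toReal_mul, ENNReal.toReal_mul, ← ENNReal.toReal_rpow,
      ENNReal.toReal_ofReal (by positivity), ENNReal.toReal_ofReal (by positivity)]

/-! ### Density of test functions and the kernel -/

theorem Vr_le_H2Zero (hm : (d : ℝ) / 2 < m) {r : ℝ} (hr : 0 < r) : Vr hm r ≤ H2Zero hm r := by
  intro v hv
  -- With `s = 1 - t n`, the shift by `2` ensures `s ≥ 1/2`. A bump of outer radius `t n * r / 2`
  -- uses half of the gap `t n * r`, so the support stays strictly inside the ball.
  let t : ℕ → ℝ := fun n => 1 / ((n : ℝ) + 2)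
  have ht0 : ∀ n, 0 < t n := fun n => by positivity
  have ht1 : ∀ n, t n ≤ 1 / 2 := fun n => by
    simp only [t]; gcongr; linarith [n.cast_nonneg (α := ℝ)]
  have ht : Tendsto t atTop (𝓝 0) :=
    tendsto_const_nhds.div_atTop (tendsto_atTop_add_const_right _ _ tendsto_natCast_atTop_atTop)
  let φ : ℕ → ContDiffBump (0 : E d) := fun n =>
    ⟨t n * r / 4, t n * r / 2, by have := ht0 n; positivity,
      by have := mul_pos (ht0 n) hr; linarith⟩
  have hφ : ∀ n, (φ n).rOut = t n * r / 2 := fun n => rfl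
  choose w hwS hw hwn using fun n => exists_testFunction_eq_mollify hv (φ n) (s := 1 - t n)
    (by linarith [ht1 n]) (by linarith [ht0 n])
    (by rw [hφ]; linarith [mul_pos (ht0 n) hr])
  refine RKHS.mem_topologicalClosure_of_tendsto_apply hwS hwn fun x => ?_
  simp only [hw]
  have hvc : Continuous v := H2.continuous_toFun v
  -- The mollified function varies with `n` as well, so the dilates must converge jointly as `n → ∞`
  -- and the argument tends to `x`.
  refine ContDiffBump.convolution_tendsto_right (k := fun _ => x) ?_
    (Eventually.of_forall fun n => (hvc.comp (by fun_prop)).aestronglyMeasurable) ?_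
    tendsto_const_nhds
  · simp only [hφ]
    simpa using (ht.mul_const r).div_const 2
  · have h1 : Tendsto (fun n => (1 - t n)⁻¹) atTop (𝓝 1) := by
      simpa using (ht.const_sub 1).inv₀ (by norm_num)
    have h2 : Tendsto (fun p : ℕ × E d => (1 - t p.1)⁻¹ • p.2) (atTop ×ˢ 𝓝 x) (𝓝 x) := by
      simpa using (h1.comp tendsto_fst).smul (tendsto_snd (f := atTop) (g := 𝓝 x))
    exact (hvc.tendsto x).comp h2

/-- The kernel functions of `H̊_2^m(B_r(0))` are the projections `g_{r,y}`. -/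
theorem coe_kerFun_H2Zero (hm : (d : ℝ) / 2 < m) {r : ℝ} (hr : 0 < r)
    (y : Metric.ball (0 : E d) r) :
    (RKHS.kerFun (H2Zero hm r) y (1 : ℝ) : H2 hm) = gr hm r y := by
  refine (Submodule.eq_starProjection_of_mem_orthogonal
    (H2Zero_le_Vr hm r (Subtype.property _)) ?_).symm
  -- Against any `v` in `V_r`, both `K(y, ·)` and the kernel function of the closure reproduce `v
  -- y`; the latter applies because `v` lies in the closure.
  rw [Submodule.mem_orthogonal']
  intro v hv
  let v' : H2Zero hm r := ⟨v, Vr_le_H2Zero hm hr hv⟩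
  have h : inner ℝ (RKHS.kerFun (H2Zero hm r) y (1 : ℝ) : H2 hm) v = inner ℝ 1 (v' y) :=
    RKHS.kerFun_inner y 1 v'
  rw [inner_sub_left, kernelTranslate, RKHS.kerFun_inner, h]
  exact sub_self _

end HSobolev

theorem mainTheorem10 {d : ℕ} {m : ℝ} (hm : (d : ℝ) / 2 < m) {r : ℝ} (hr : 0 < r)
    (x y : Metric.ball (0 : EuclideanSpace ℝ (Fin d)) r) :
    RKHS.kernel (HSobolev.H2Zero hm r) x y 1 = HSobolev.Kr hm r x y := by
  have h := RKHS.kernel_inner (HSobolev.H2Zero hm r) x y (1 : ℝ) (1 : ℝ)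
  rw [Submodule.coe_inner, HSobolev.coe_kerFun_H2Zero hm hr, HSobolev.coe_kerFun_H2Zero hm hr] at h
  -- `RKHS.kernel_inner` pairs the kernel functions in the opposite order, hence the use of
  -- symmetry.
  rw [HSobolev.Kr, real_inner_comm, ← h]
  simp
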